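/- **Model.** There are $M$ items, ranked $1,\dots,M$ ($1$ is the top). $M_1$ of them, with $1\le M_1\le M-1$, are of class $1$; the other $M_0=M-M_1$ are of class $0$. Individuals $n=1,2,\dots$ arrive one after the other, and each clicks on exactly one item. Individual $n$ sees a ranking in which item $m$ has rank $r_{n,m}$. The first ranking $r_1$ is given. For $n\ge 2$, $r_n$ is determined by the first $n-1$ clicks by a fixed deterministic rule that gives every item with strictly more clicks a strictly better rank; ties may be broken by any rule depending on the click history. Independently of the past, individual $n$ has parameter $\gamma_n=1$ with probability $p$, $\gamma_n=0$ with probability $p$ and $\gamma_n=\tfrac12$ with probability $1-2p$, where $0<p<\tfrac12$ (extreme symmetric types). Given $\gamma_n$ and $r_n$, individual $n$ clicks on item $m$ with probability $$\rho_{n,m}=\frac{\beta^{M-r_{n,m}}\varphi_{n,m}}{\sum_{m'}\beta^{M-r_{n,m'}}\varphi_{n,m'}},\qquad \varphi_{n,m}=\begin{cases}\gamma_n/M_0,& m\text{ of class }0,\\ (1-\gamma_n)/M_1,& m\text{ of class }1,\end{cases}$$ where $\beta>1$. **Proposition.** Fix $M$, $\beta>1$ and integers $1\le M_1$, $M_1'\le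 M-1$ with $$M_1<\frac{M}{1+\beta}<\frac{\beta M}{1+\beta}<M_1'.$$ Then there is $p_0\in(0,\tfrac12]$ such that the following holds for every $p\in(0,p_0)$. Let $\mathcal E$ and $\mathcal E'$ be two such environments with the same $M$, $\beta$, $p$, initial ranking $r_1$ and ranking rule, whose sets of class-$1$ items are arbitrary sets of $M_1$ and $M_1'$ items, respectively. Then there is $\overline N$ such that, for all $N\ge\overline N$, the total (unconditional) probability that individual $N$ clicks on a class-$1$ item is strictly larger in $\mathcal E$ than in $\mathcal E'$. -/

import Mathlib

/-- A popularity-based ranking algorithm on `M` items with initial ranking `r₁`.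
It sends every click history (most recent click first) to a ranking, where `rank h m` is the
rank of item `m`, counted from `0` (top).  Before any click the ranking is `r₁`, and an item with
strictly more recorded clicks always has a strictly better rank.  Nothing is imposed on how ties
are broken. -/
structure PopularityRanking (M : ℕ) (r₁ : Equiv.Perm (Fin M)) where
  rank : List (Fin M) → Equiv.Perm (Fin M)
  rank_nil : rank [] = r₁
  rank_lt_rank : ∀ (h : List (Fin M)) (i j : Fin M), h.count j < h.count i → rank h i < rank h j

/-- A search environment with `M` items and initial ranking `r₁`. -/
structure SearchEnvironment (M : ℕ) (r₁ : Equiv.Perm (Fin M)) where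
  /-- The set of items of class 1; all other items are of class 0. -/
  classOne : Finset (Fin M)
  /-- The attention bias. -/
  β : ℝ
  /-- `Γ i` is the probability that an individual of Type `i` clicks on class 0 absent ranking. -/
  Γ : Fin 3 → ℝ
  /-- `typeProb i` is the proportion of individuals of Type `i`. -/
  typeProb : Fin 3 → ℝ
  /-- The ranking algorithm. -/
  ranking : PopularityRanking M r₁

namespace SearchEnvironment

variable {M : ℕ} {r₁ : Equiv.Perm (Fin M)}

/-- The rank, in `{1, …, M}`, of item `m` after the click history `h`. -/
def position (E : SearchEnvironment M r₁) (h : List (Fin M)) (m : Fin M) : ℕ :=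
  (E.ranking.rank h m : ℕ) + 1

/-- The propensity of an individual with parameter `γ` to click on item `m`. -/
noncomputable def propensity (E : SearchEnvironment M r₁) (γ : ℝ) (m : Fin M) : ℝ :=
  if m ∈ E.classOne then (1 - γ) / (E.classOne.card : ℝ) else γ / (E.classOneᶜ.card : ℝ)

/-- The probability that an individual with parameter `γ`, who sees the ranking produced by the
click history `h`, clicks on item `m`. -/
noncomputable def typeClickProb (E : SearchEnvironment M r₁) (γ : ℝ) (h : List (Fin M))
    (m : Fin M) : ℝ :=
  E.β ^ (M - E.position h m) * E.propensity γ m /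
    ∑ m' : Fin M, E.β ^ (M - E.position h m') * E.propensity γ m'

/-- The conditional probability, given the click history `h`, that the next individual clicks on
item `m`; the type of this individual is drawn from `typeProb` independently of the past. -/
noncomputable def clickProb (E : SearchEnvironment M r₁) (h : List (Fin M)) (m : Fin M) : ℝ :=
  ∑ i : Fin 3, E.typeProb i * E.typeClickProb (E.Γ i) h m

/-- The probability that the click history `h` (most recent click first) is the one realized by
the first `h.length` individuals. -/
noncomputable def historyProb (E : SearchEnvironment M r₁) : List (Fin M) → ℝ
  | [] => 1
  | m :: h => historyProb E h * E.clickProb h m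

/-- The total probability that individual `N` (`N = 1, 2, …`) clicks on an item of class 1: the
sum over all histories of the `N - 1` preceding clicks. -/
noncomputable def classOneClickProb (E : SearchEnvironment M r₁) (N : ℕ) : ℝ :=
  ∑ h : List.Vector (Fin M) (N - 1),
    E.historyProb h.toList * ∑ m ∈ E.classOne, E.clickProb h.toList m

/-- The search environment with extreme symmetric types: `Γ = (1, 0, 1/2)`, in proportions
`(p, p, 1 - 2p)`. -/
noncomputable def extremeSymmetric (C : Finset (Fin M)) (β p : ℝ) (R : PopularityRanking M r₁) :
    SearchEnvironment M r₁ where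
  classOne := C
  β := β
  Γ := ![1, 0, 1 / 2]
  typeProb := ![p, p, 1 - 2 * p]
  ranking := R

end SearchEnvironment

/-! One half separates the two environments: a small class eventually draws more than half of the
clicks, and a large one less than half. The second claim follows from the first, since swapping the
class labels leaves the click process unchanged (`clickProb_compl`) and the complement of the large
class is small.

A click probability is the attention of the rank times a factor depending only on the class. For a
small class `C` and small `p`, the factor of `C` exceeds that of `Cᶜ` by more than `β`, so an item
of `C` beats an item of `Cᶜ` even from one place below it; within a class the better ranked item
wins by at least `β` (`favoursClass_clickProb`). Hence ties within a class are exponentially rare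
and the order inside each class freezes. Given that order, the items of `C` overtake those of `Cᶜ`
pair by pair, best of `C` against worst of `Cᶜ` first: once the earlier pairs are settled, an item
of `C` is never two places below its rival, so the drift is favourable (`exponentiallyRare_cross`).
All of `C` then leads, outside an event of vanishing probability, and on this event its click share
is bounded away from one half.

The probabilistic engine is `ExponentiallyRare.of_drift`, an exponential supermartingale bound that
tolerates an exponentially rare exceptional event. -/

/-! ### Expectations over histories and exponentially rare events. -/

section AdaptedChain

variable {α : Type*} [Fintype α]

/-- The expectation of `g` at the history of the first `n` draws, when `π h m` is the conditional
probability of drawing `m` after the history `h` (most recent draw first). -/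
noncomputable def historyExpectation (π : List α → α → ℝ) : ℕ → (List α → ℝ) → ℝ
  | 0, g => g []
  | n + 1, g => historyExpectation π n fun h => ∑ m, π h m * g (m :: h)

/-- `π h` is a probability vector for every history `h`. -/
structure IsTransition (π : List α → α → ℝ) : Prop where
  nonneg : ∀ h m, 0 ≤ π h m
  sum_eq_one : ∀ h, ∑ m, π h m = 1

/-- The probability of `B` decays exponentially in time. -/
def ExponentiallyRare (π : List α → α → ℝ) (B : Set (List α)) : Prop :=
  ∃ K θ : ℝ, 0 ≤ K ∧ 0 < θ ∧ θ < 1 ∧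
    ∀ n, historyExpectation π n (B.indicator 1) ≤ K * θ ^ n

variable {π : List α → α → ℝ}

theorem historyExpectation_mono (hπ : IsTransition π) (n : ℕ) {f g : List α → ℝ}
    (hfg : ∀ h : List α, h.length = n → f h ≤ g h) :
    historyExpectation π n f ≤ historyExpectation π n g := by
  induction n generalizing f g with
  | zero => exact hfg [] rfl
  | succ n ih =>
    refine ih fun h hh => Finset.sum_le_sum fun m _ => ?_
    exact mul_le_mul_of_nonneg_left (hfg _ (by simp [hh])) (hπ.nonneg h m)

theorem historyExpectation_add (n : ℕ) (f g : List α → ℝ) :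
    historyExpectation π n (fun h => f h + g h) =
      historyExpectation π n f + historyExpectation π n g := by
  induction n generalizing f g with
  | zero => rfl
  | succ n ih =>
    simp only [historyExpectation, mul_add, Finset.sum_add_distrib]
    exact ih _ _

theorem historyExpectation_const_mul (n : ℕ) (c : ℝ) (f : List α → ℝ) :
    historyExpectation π n (fun h => c * f h) = c * historyExpectation π n f := by
  induction n generalizing f with
  | zero => rfl
  | succ n ih =>
    simp only [historyExpectation]
    rw [← ih]
    congr 1
    funext h
    rw [Finset.mul_sum]
    exact Finset.sum_congr rfl fun m _ => by ring

theorem historyExpectation_const (hπ : IsTransition π) (n : ℕ) (c : ℝ) :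
    historyExpectation π n (fun _ => c) = c := by
  induction n with
  | zero => rfl
  | succ n ih =>
    simp only [historyExpectation, ← Finset.sum_mul, hπ.sum_eq_one, one_mul]
    exact ih

theorem ExponentiallyRare.mono (hπ : IsTransition π) {A B : Set (List α)}
    (hB : ExponentiallyRare π B) (hAB : A ⊆ B) : ExponentiallyRare π A := by
  obtain ⟨K, θ, hK, hθ, hθ1, h⟩ := hB
  refine ⟨K, θ, hK, hθ, hθ1, fun n => le_trans (historyExpectation_mono hπ n fun x _ => ?_) (h n)⟩
  exact Set.indicator_le_indicator_of_subset hAB (fun _ => zero_le_one) x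

theorem exponentiallyRare_empty : ExponentiallyRare π ∅ := by
  refine ⟨0, 1 / 2, le_rfl, by norm_num, by norm_num, fun n => ?_⟩
  have := historyExpectation_const_mul (π := π) n 0 (fun _ => 0)
  simp only [zero_mul] at this
  rw [Set.indicator_empty, this]
  simp

theorem ExponentiallyRare.union (hπ : IsTransition π) {A B : Set (List α)}
    (hA : ExponentiallyRare π A) (hB : ExponentiallyRare π B) : ExponentiallyRare π (A ∪ B) := by
  obtain ⟨K, θ, hK, hθ, hθ1, h⟩ := hA
  obtain ⟨K', θ', hK', hθ', hθ1', h'⟩ := hB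
  refine ⟨K + K', max θ θ', by positivity, lt_max_of_lt_left hθ, max_lt hθ1 hθ1', fun n => ?_⟩
  calc historyExpectation π n ((A ∪ B).indicator 1)
      ≤ historyExpectation π n (fun x => A.indicator 1 x + B.indicator 1 x) := by
        refine historyExpectation_mono hπ n fun x _ => ?_
        by_cases hxA : x ∈ A <;> by_cases hxB : x ∈ B <;> simp [hxA, hxB]
    _ ≤ K * θ ^ n + K' * θ' ^ n := by
        rw [historyExpectation_add]
        exact add_le_add (h n) (h' n)
    _ ≤ (K + K') * max θ θ' ^ n := by
        rw [add_mul]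
        gcongr
        · exact le_max_left _ _
        · exact le_max_right _ _

theorem ExponentiallyRare.iUnion (hπ : IsTransition π) {ι : Type*} [Finite ι]
    {B : ι → Set (List α)} (hB : ∀ i, ExponentiallyRare π (B i)) :
    ExponentiallyRare π (⋃ i, B i) := by
  classical
  cases nonempty_fintype ι
  have key : ∀ s : Finset ι, ExponentiallyRare π (⋃ i ∈ s, B i) := by
    intro s
    induction s using Finset.induction_on with
    | empty => simpa using exponentiallyRare_empty
    | insert a s _ ih =>
      rw [Finset.set_biUnion_insert]
      exact (hB a).union hπ ih
  simpa using key Finset.univ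

/-! ### From positive drift to exponential rarity. -/

/-- The rate is taken strictly between `max a b` and `1`: the gap lets a large constant absorb the
forcing term, even when `a = b`. -/
theorem exists_geometric_bound {u : ℕ → ℝ} {a b K : ℝ} (ha : 0 < a) (ha1 : a < 1) (hb : 0 < b)
    (hb1 : b < 1) (hK : 0 ≤ K) (h0 : u 0 ≤ 1) (hu : ∀ n, u (n + 1) ≤ a * u n + K * b ^ n) :
    ∃ L ρ : ℝ, 0 ≤ L ∧ 0 < ρ ∧ ρ < 1 ∧ ∀ n, u n ≤ L * ρ ^ n := by
  set c := max a b
  have hc1 : c < 1 := max_lt ha1 hb1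
  have hac : a ≤ c := le_max_left a b
  have hbc : b ≤ c := le_max_right a b
  set ρ := (1 + c) / 2 with hρ
  have hcρ : 0 < ρ - c := by rw [hρ]; linarith
  set L := 1 + K / (ρ - c) with hL
  have hL1 : 1 ≤ L := by rw [hL]; linarith [div_nonneg hK hcρ.le]
  have hLK : K ≤ L * (ρ - c) := by
    rw [hL, add_mul, div_mul_cancel₀ _ hcρ.ne']
    linarith
  have hρ0 : 0 < ρ := by linarith
  refine ⟨L, ρ, by linarith, hρ0, by rw [hρ]; linarith, fun n => ?_⟩
  induction n with
  | zero => simpa using h0.trans hL1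
  | succ n ih =>
    have h1 : b ^ n ≤ ρ ^ n := pow_le_pow_left₀ hb.le (by linarith) n
    have h2 : 0 < ρ ^ n := pow_pos hρ0 n
    calc u (n + 1) ≤ a * u n + K * b ^ n := hu n
      _ ≤ a * (L * ρ ^ n) + K * ρ ^ n := by gcongr
      _ ≤ c * (L * ρ ^ n) + L * (ρ - c) * ρ ^ n := by gcongr
      _ = L * ρ ^ (n + 1) := by ring

/-- Exponential moment bound for one step with bounded increments and positive drift. -/
theorem sum_mul_exp_neg_le {w x : α → ℝ} {s δ : ℝ} (hw : ∀ m, 0 ≤ w m) (hw1 : ∑ m, w m = 1)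
    (hx : ∀ m, |x m| ≤ 1) (hs : 0 ≤ s) (hs1 : s ≤ 1) (hsδ : s ≤ δ / 2)
    (hδ : δ ≤ ∑ m, w m * x m) :
    ∑ m, w m * Real.exp (-(s * x m)) ≤ 1 - s * δ / 2 := by
  have step : ∀ m, w m * Real.exp (-(s * x m)) ≤ w m * (1 + s ^ 2) - s * (w m * x m) := by
    -- Uses `exp y ≤ 1 + y + y ^ 2` for `|y| ≤ 1`.
    intro m
    have habs : |-(s * x m)| ≤ 1 := by
      rw [abs_neg, abs_mul, abs_of_nonneg hs]
      exact mul_le_one₀ hs1 (abs_nonneg _) (hx m)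
    have h1 := (abs_le.mp (Real.abs_exp_sub_one_sub_id_le habs)).2
    have h2 : (-(s * x m)) ^ 2 ≤ s ^ 2 := by
      have : x m ^ 2 ≤ 1 := (sq_le_one_iff_abs_le_one _).mpr (hx m)
      nlinarith [sq_nonneg s]
    have h3 : Real.exp (-(s * x m)) ≤ 1 + s ^ 2 - s * x m := by linarith
    calc w m * Real.exp (-(s * x m)) ≤ w m * (1 + s ^ 2 - s * x m) :=
          mul_le_mul_of_nonneg_left h3 (hw m)
      _ = _ := by ring
  calc ∑ m, w m * Real.exp (-(s * x m))
      ≤ ∑ m, (w m * (1 + s ^ 2) - s * (w m * x m)) := Finset.sum_le_sum fun m _ => step m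
    _ = 1 + s ^ 2 - s * ∑ m, w m * x m := by
        rw [Finset.sum_sub_distrib, ← Finset.sum_mul, ← Finset.mul_sum, hw1, one_mul]
    _ ≤ 1 - s * δ / 2 := by nlinarith

/-- If `D` moves by at most one and has a uniformly positive drift on `S` outside an exponentially
rare event, and `S` can only be entered from that event, then `D ≤ 0` is exponentially rare
on `S`. -/
theorem ExponentiallyRare.of_drift (hπ : IsTransition π) {D : List α → ℝ} {S B : Set (List α)}
    {δ : ℝ} (hδ : 0 < δ) (hB : ExponentiallyRare π B) (hD0 : D [] = 0)
    (hD : ∀ h m, |D (m :: h) - D h| ≤ 1)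
    (hS : ∀ h m, h ∉ B → m :: h ∈ S → h ∈ S)
    (hdrift : ∀ h ∈ S, h ∉ B → δ ≤ ∑ m, π h m * (D (m :: h) - D h)) :
    ExponentiallyRare π (S ∩ {h | D h ≤ 0}) := by
  obtain ⟨K, θ, hK, hθ, hθ1, hKθ⟩ := hB
  have hlog : Real.log θ < 0 := Real.log_neg hθ hθ1
  -- The first two bounds serve the one-step moment estimate, `1 / δ` keeps the contraction factor
  -- positive, and the last gives `exp s * θ < 1`, so that the rarity of `B` outweighs the largest
  -- possible growth of `exp (-(s * D))`.
  set s := min (min 1 (δ / 2)) (min (1 / δ) (-Real.log θ / 2))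
  have hs : 0 < s :=
    lt_min (lt_min one_pos (by positivity)) (lt_min (by positivity) (by linarith))
  have hs1 : s ≤ 1 := (min_le_left _ _).trans (min_le_left _ _)
  have hsδ : s ≤ δ / 2 := (min_le_left _ _).trans (min_le_right _ _)
  have hsθ : s ≤ -Real.log θ / 2 := (min_le_right _ _).trans (min_le_right _ _)
  have hsδ1 : s * δ ≤ 1 := (le_div_iff₀ hδ).mp ((min_le_right _ _).trans (min_le_left _ _))
  have ha : 0 < 1 - s * δ / 2 := by linarith
  have hlen : ∀ h : List α, -D h ≤ h.length := by
    intro h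
    induction h with
    | nil => simp [hD0]
    | cons m h ih =>
      have := (abs_le.mp (hD h m)).1
      push_cast [List.length_cons]
      linarith
  have hb1 : Real.exp s * θ < 1 := by
    rw [← Real.exp_log hθ, ← Real.exp_add, Real.exp_lt_one_iff]
    linarith
  set X : List α → ℝ := fun h => S.indicator (fun h => Real.exp (-(s * D h))) h with hX
  have hXle : ∀ h, X h ≤ Real.exp (-(s * D h)) := fun h =>
    Set.indicator_le_self' (fun _ _ => (Real.exp_pos _).le) h
  have hX0 : ∀ h, 0 ≤ X h := fun h => Set.indicator_nonneg (fun _ _ => (Real.exp_pos _).le) h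
  have hstep : ∀ n, historyExpectation π (n + 1) X ≤
      (1 - s * δ / 2) * historyExpectation π n X + (K * Real.exp s) * (Real.exp s * θ) ^ n := by
    intro n
    calc historyExpectation π (n + 1) X
        = historyExpectation π n (fun h => ∑ m, π h m * X (m :: h)) := rfl
      _ ≤ historyExpectation π n (fun h => (1 - s * δ / 2) * X h +
            Real.exp s ^ (n + 1) * B.indicator 1 h) := by
          refine historyExpectation_mono hπ n fun h hh => ?_
          -- On `B` only the crude bound `-D ≤ n + 1` is used; off `B` and off `S` the next value
          -- vanishes because `S` cannot be entered.
          by_cases hhB : h ∈ B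
          · have h1 : ∑ m, π h m * X (m :: h) ≤ Real.exp s ^ (n + 1) := by
              calc ∑ m, π h m * X (m :: h) ≤ ∑ m, π h m * Real.exp s ^ (n + 1) := by
                    refine Finset.sum_le_sum fun m _ =>
                      mul_le_mul_of_nonneg_left ((hXle _).trans ?_) (hπ.nonneg h m)
                    rw [← Real.exp_nat_mul]
                    refine Real.exp_le_exp.mpr ?_
                    have := hlen (m :: h)
                    rw [List.length_cons, hh] at this
                    nlinarith
                _ = _ := by rw [← Finset.sum_mul, hπ.sum_eq_one, one_mul]
            have h2 : 0 ≤ (1 - s * δ / 2) * X h := mul_nonneg ha.le (hX0 h)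
            simp only [Set.indicator_of_mem hhB, Pi.one_apply, mul_one]
            linarith
          · rw [Set.indicator_of_notMem hhB, mul_zero, add_zero]
            by_cases hhS : h ∈ S
            · have hXh : X h = Real.exp (-(s * D h)) := Set.indicator_of_mem hhS _
              calc ∑ m, π h m * X (m :: h)
                  ≤ ∑ m, π h m * Real.exp (-(s * D (m :: h))) :=
                    Finset.sum_le_sum fun m _ =>
                      mul_le_mul_of_nonneg_left (hXle _) (hπ.nonneg h m)
                _ = (∑ m, π h m * Real.exp (-(s * (D (m :: h) - D h)))) * X h := by
                    rw [Finset.sum_mul]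
                    refine Finset.sum_congr rfl fun m _ => ?_
                    rw [hXh, mul_assoc, ← Real.exp_add]
                    congr 2
                    ring
                _ ≤ _ := mul_le_mul_of_nonneg_right
                    (sum_mul_exp_neg_le (hπ.nonneg h) (hπ.sum_eq_one h) (hD h) hs.le hs1 hsδ
                      (hdrift h hhS hhB)) (hX0 h)
            · have h0 : ∀ m, X (m :: h) = 0 := fun m =>
                Set.indicator_of_notMem (fun hm => hhS (hS h m hhB hm)) _
              simp only [h0, mul_zero, Finset.sum_const_zero]
              exact mul_nonneg ha.le (hX0 h)
      _ ≤ _ := by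
          rw [historyExpectation_add, historyExpectation_const_mul, historyExpectation_const_mul]
          have := mul_le_mul_of_nonneg_left (hKθ n)
            (pow_nonneg (Real.exp_pos s).le (n + 1))
          calc _ ≤ _ := add_le_add_right this _
            _ = _ := by ring
  have hX00 : historyExpectation π 0 X ≤ 1 := (hXle []).trans (by simp [hD0])
  obtain ⟨L, ρ, hL, hρ, hρ1, hbound⟩ := exists_geometric_bound
    (u := fun n => historyExpectation π n X) ha (by linarith [mul_pos hs hδ])
    (mul_pos (Real.exp_pos s) hθ) hb1 (mul_nonneg hK (Real.exp_pos s).le) hX00 hstep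
  refine ⟨L, ρ, hL, hρ, hρ1, fun n => (historyExpectation_mono hπ n fun h _ => ?_).trans
    (hbound n)⟩
  -- Markov's inequality: `X ≥ 1` on the target event.
  by_cases hh : h ∈ S ∩ {h | D h ≤ 0}
  · rw [Set.indicator_of_mem hh, hX]
    simp only [Set.indicator_of_mem hh.1, Pi.one_apply]
    exact Real.one_le_exp (neg_nonneg.mpr (mul_nonpos_of_nonneg_of_nonpos hs.le hh.2))
  · rw [Set.indicator_of_notMem hh]
    exact hX0 h

end AdaptedChain

/-! ### Ties, frozen order within classes, and overtaking between classes. -/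

section PopularityRanking

variable {M : ℕ} {r₁ : Equiv.Perm (Fin M)} {R : PopularityRanking M r₁}
  {π : List (Fin M) → Fin M → ℝ} {C : Finset (Fin M)}

/-- The click probabilities favour, by a factor `ratio > 1`, the better ranked of two items of the
same class, and an item of `C` over an item of `Cᶜ` unless it is ranked two or more places
lower. -/
structure FavoursClass (R : PopularityRanking M r₁) (π : List (Fin M) → Fin M → ℝ)
    (C : Finset (Fin M)) (ratio η : ℝ) : Prop where
  one_lt : 1 < ratio
  pos : 0 < η
  le_prob : ∀ h m, η ≤ π h m
  same : ∀ h a b, (a ∈ C ↔ b ∈ C) → R.rank h a < R.rank h b → ratio * π h b ≤ π h a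
  cross : ∀ h a b, a ∈ C → b ∉ C → (R.rank h a : ℕ) ≤ R.rank h b + 1 → ratio * π h b ≤ π h a

/-- The histories after which two items of the same class have equally many clicks. -/
def sameClassTie (C : Finset (Fin M)) : Set (List (Fin M)) :=
  {h | ∃ a b, a ≠ b ∧ (a ∈ C ↔ b ∈ C) ∧ h.count a = h.count b}

/-- The histories whose click counts are, within each class, strictly ordered by `σ`. -/
def orderedWithin (C : Finset (Fin M)) (σ : Equiv.Perm (Fin M)) : Set (List (Fin M)) :=
  {h | ∀ a b, (a ∈ C ↔ b ∈ C) → σ a < σ b → h.count b < h.count a}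

/-- The histories after which every item of `C` has more clicks than every other item. -/
def classLeads (C : Finset (Fin M)) : Set (List (Fin M)) :=
  {h | ∀ i ∈ C, ∀ j ∉ C, h.count j < h.count i}

theorem count_cons_cast (m a : Fin M) (h : List (Fin M)) :
    (((m :: h).count a : ℕ) : ℝ) = h.count a + if m = a then 1 else 0 := by
  rw [List.count_cons]
  by_cases hm : m = a <;> simp [hm]

theorem abs_count_sub_step_le (a b m : Fin M) (h : List (Fin M)) :
    |(((m :: h).count a : ℝ) - (m :: h).count b) - ((h.count a : ℝ) - h.count b)| ≤ 1 := by
  rw [count_cons_cast, count_cons_cast]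
  split_ifs <;> simp

theorem sum_mul_count_sub_step (a b : Fin M) (h : List (Fin M)) :
    ∑ m, π h m * ((((m :: h).count a : ℝ) - (m :: h).count b) - ((h.count a : ℝ) - h.count b)) =
      π h a - π h b := by
  have : ∀ m, π h m *
      ((((m :: h).count a : ℝ) - (m :: h).count b) - ((h.count a : ℝ) - h.count b)) =
      (if m = a then π h m else 0) - if m = b then π h m else 0 := by
    intro m
    rw [count_cons_cast, count_cons_cast]
    split_ifs <;> simp
  simp [this, Finset.sum_sub_distrib]

theorem FavoursClass.drift_le {ratio η x y : ℝ} (hF : FavoursClass R π C ratio η)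
    (hx : η ≤ x) (hxy : ratio * y ≤ x) : (1 - 1 / ratio) * η ≤ x - y := by
  have h1 := hF.one_lt
  have h0 : 0 < ratio := by linarith
  have h2 : y ≤ 1 / ratio * x := by
    rw [one_div, inv_mul_eq_div, le_div_iff₀ h0]
    linarith
  have h3 : 0 ≤ 1 - 1 / ratio := by
    rw [sub_nonneg, div_le_one h0]
    exact h1.le
  calc (1 - 1 / ratio) * η ≤ (1 - 1 / ratio) * x := mul_le_mul_of_nonneg_left hx h3
    _ ≤ x - y := by linarith

theorem FavoursClass.drift_pos {ratio η : ℝ} (hF : FavoursClass R π C ratio η) :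
    0 < (1 - 1 / ratio) * η := by
  have h1 := hF.one_lt
  refine mul_pos ?_ hF.pos
  rw [sub_pos, div_lt_one (by linarith)]
  exact h1

/-- The absolute gap between the two counts has uniformly positive drift: the leader is ranked
better and gains faster, and from a tie any click on either item opens the gap. -/
theorem exponentiallyRare_tie (hπ : IsTransition π) {ratio η : ℝ}
    (hF : FavoursClass R π C ratio η) {a b : Fin M} (hab : a ≠ b) (hC : a ∈ C ↔ b ∈ C) :
    ExponentiallyRare π {h | h.count a = h.count b} := by
  set D : List (Fin M) → ℝ := fun h => |(h.count a : ℝ) - h.count b| with hD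
  have main : ExponentiallyRare π (Set.univ ∩ {h | D h ≤ 0}) := by
    refine ExponentiallyRare.of_drift hπ hF.drift_pos exponentiallyRare_empty (by simp [hD])
      (fun h m => ?_) (fun _ _ _ _ => trivial) fun h _ _ => ?_
    · exact (abs_abs_sub_abs_le_abs_sub _ _).trans (abs_count_sub_step_le a b m h)
    · have lead : ∀ a b : Fin M, (a ∈ C ↔ b ∈ C) → h.count b < h.count a →
          (1 - 1 / ratio) * η ≤ ∑ m, π h m *
            (|((m :: h).count a : ℝ) - (m :: h).count b| - |(h.count a : ℝ) - h.count b|) := by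
        intro a b hC hlt
        refine (hF.drift_le (hF.le_prob h a)
          (hF.same h a b hC (R.rank_lt_rank h a b hlt))).trans ?_
        rw [← sum_mul_count_sub_step]
        refine Finset.sum_le_sum fun m _ => mul_le_mul_of_nonneg_left ?_ (hπ.nonneg h m)
        rw [abs_of_pos (sub_pos.mpr (Nat.cast_lt.mpr hlt) : (0 : ℝ) < h.count a - h.count b)]
        exact sub_le_sub_right (le_abs_self _) _
      rcases lt_trichotomy (h.count a) (h.count b) with hlt | heq | hgt
      · have := lead b a hC.symm hlt
        simpa only [abs_sub_comm] using this
      · have hstep : ∀ m, (if m = a then π h m else 0) ≤ π h m * (D (m :: h) - D h) := by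
          intro m
          simp only [hD, heq, sub_self, abs_zero, sub_zero]
          split_ifs with hm
          · subst hm
            simp [heq, hab]
          · exact mul_nonneg (hπ.nonneg h m) (abs_nonneg _)
        calc (1 - 1 / ratio) * η ≤ π h a - 0 :=
              hF.drift_le (hF.le_prob h a) (by simpa using hπ.nonneg h a)
          _ = ∑ m, if m = a then π h m else 0 := by simp
          _ ≤ _ := Finset.sum_le_sum fun m _ => hstep m
      · exact lead a b hC hgt
  refine main.mono hπ fun h hh => ⟨trivial, ?_⟩
  have hh' : h.count a = h.count b := hh
  simp [hD, hh']

theorem exponentiallyRare_sameClassTie (hπ : IsTransition π) {ratio η : ℝ}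
    (hF : FavoursClass R π C ratio η) : ExponentiallyRare π (sameClassTie C) := by
  have key : ExponentiallyRare π
      (⋃ x : {x : Fin M × Fin M // x.1 ≠ x.2 ∧ (x.1 ∈ C ↔ x.2 ∈ C)},
        {h : List (Fin M) | h.count x.1.1 = h.count x.1.2}) :=
    ExponentiallyRare.iUnion hπ fun x => exponentiallyRare_tie hπ hF x.2.1 x.2.2
  refine key.mono hπ ?_
  rintro h ⟨a, b, hab, hC, heq⟩
  exact Set.mem_iUnion.mpr ⟨⟨(a, b), hab, hC⟩, heq⟩

/-- Within a class the order can change only through a tie. -/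
theorem orderedWithin_of_cons {σ : Equiv.Perm (Fin M)} {h : List (Fin M)} {m : Fin M}
    (hh : h ∉ sameClassTie C) (hm : m :: h ∈ orderedWithin C σ) : h ∈ orderedWithin C σ := by
  intro a b hC hab
  have h1 := hm a b hC hab
  have h2 : h.count a ≠ h.count b := fun heq => hh ⟨a, b, fun e => by simp [e] at hab, hC, heq⟩
  rw [List.count_cons, List.count_cons] at h1
  split_ifs at h1 <;> omega

/-- Induction over pairs in lexicographic order, increasing in `σ i` and then decreasing in `σ j`,
encoded in one number. Pairs with a smaller code are already settled outside a rare event. -/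
theorem exponentiallyRare_cross (hπ : IsTransition π) {ratio η : ℝ}
    (hF : FavoursClass R π C ratio η) (σ : Equiv.Perm (Fin M)) (n : ℕ) :
    ∀ i ∈ C, ∀ j ∉ C, (σ i : ℕ) * M + (M - 1 - σ j) = n →
      ExponentiallyRare π (orderedWithin C σ ∩ {h | h.count i ≤ h.count j}) := by
  induction n using Nat.strong_induction_on with
  | _ n ih =>
  intro i hi j hj hn
  set B : Set (List (Fin M)) := sameClassTie C ∪
    ⋃ x : {x : Fin M × Fin M // x.1 ∈ C ∧ x.2 ∉ C ∧
      (σ x.1 : ℕ) * M + (M - 1 - σ x.2) < n},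
      orderedWithin C σ ∩ {h | h.count x.1.1 ≤ h.count x.1.2}
  have hB : ExponentiallyRare π B := (exponentiallyRare_sameClassTie hπ hF).union hπ
    (ExponentiallyRare.iUnion hπ fun x => ih _ x.2.2.2 _ x.2.1 _ x.2.2.1 rfl)
  have main := ExponentiallyRare.of_drift hπ
    (D := fun h => (h.count i : ℝ) - h.count j) (S := orderedWithin C σ) hF.drift_pos hB
    (by simp) (fun h m => abs_count_sub_step_le i j m h)
    (fun h m hhB hm => orderedWithin_of_cons (fun ht => hhB (Or.inl ht)) hm)
    (fun h hhS hhB => by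
      rw [sum_mul_count_sub_step]
      refine hF.drift_le (hF.le_prob h i) (hF.cross h i j hi hj ?_)
      have lead : ∀ a ∈ C, ∀ b ∉ C, (σ a : ℕ) * M + (M - 1 - σ b) < n →
          R.rank h a < R.rank h b := by
        intro a ha b hb hlt
        refine R.rank_lt_rank h a b ?_
        by_contra hle
        exact hhB (Or.inr (Set.mem_iUnion.mpr ⟨⟨(a, b), ha, hb, hlt⟩, hhS, not_lt.mp hle⟩))
      have order : ∀ a b, (a ∈ C ↔ b ∈ C) → R.rank h a < R.rank h b → σ a < σ b := by
        intro a b hC hab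
        by_contra hle
        rcases (not_lt.mp hle).lt_or_eq with hlt | heq
        · exact absurd (R.rank_lt_rank h b a (hhS b a hC.symm hlt)) hab.asymm
        · exact hab.ne (congrArg _ (σ.injective heq.symm))
      -- If `i` were two places below `j`, consider the item `k` just below `j`. If `k ∈ C`, then
      -- `(k, j)` is an earlier pair and `k` should be above `j`; otherwise `(i, k)` is earlier and
      -- `i` should be above `k`.
      by_contra hgap
      have hlt : (R.rank h j : ℕ) + 1 < R.rank h i := not_le.mp hgap
      obtain ⟨k, hk⟩ := (R.rank h).surjective ⟨R.rank h j + 1, hlt.trans (R.rank h i).2⟩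
      have hk' : (R.rank h k : ℕ) = R.rank h j + 1 := by rw [hk]
      have hjk : R.rank h j < R.rank h k := Fin.lt_def.mpr (by omega)
      have hki : R.rank h k < R.rank h i := Fin.lt_def.mpr (by omega)
      by_cases hkC : k ∈ C
      · have h1 : (σ k : ℕ) < σ i := order k i (by simp [hkC, hi]) hki
        refine absurd (lead k hkC j hj ?_) hjk.asymm
        have h2 : ((σ k : ℕ) + 1) * M ≤ σ i * M := Nat.mul_le_mul_right M h1
        rw [add_mul, one_mul] at h2
        have := (σ j).2
        omega
      · have h1 : (σ j : ℕ) < σ k := order j k (by simp [hkC, hj]) hjk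
        refine absurd (lead i hi k hkC ?_) hki.asymm
        have := (σ k).2
        omega)
  refine main.mono hπ fun h hh => ⟨hh.1, ?_⟩
  have : h.count i ≤ h.count j := hh.2
  simpa using this

/-- Outside an exponentially rare event, every item of the favoured class leads. -/
theorem exponentiallyRare_compl_classLeads (hπ : IsTransition π) {ratio η : ℝ}
    (hF : FavoursClass R π C ratio η) : ExponentiallyRare π (classLeads C)ᶜ := by
  have key : ExponentiallyRare π (sameClassTie C ∪
      ⋃ x : Equiv.Perm (Fin M) × {x : Fin M × Fin M // x.1 ∈ C ∧ x.2 ∉ C},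
        orderedWithin C x.1 ∩ {h | h.count x.2.1.1 ≤ h.count x.2.1.2}) :=
    (exponentiallyRare_sameClassTie hπ hF).union hπ (ExponentiallyRare.iUnion hπ fun x =>
      exponentiallyRare_cross hπ hF x.1 _ _ x.2.2.1 _ x.2.2.2 rfl)
  refine key.mono hπ fun h hh => ?_
  by_cases ht : h ∈ sameClassTie C
  · exact Or.inl ht
  simp only [classLeads, Set.mem_compl_iff, Set.mem_ofPred_eq, not_forall, not_lt] at hh
  obtain ⟨i, hi, j, hj, hij⟩ := hh
  -- Without ties within a class, the current ranking itself serves as `σ`; there are finitely many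
  -- such permutations.
  refine Or.inr (Set.mem_iUnion.mpr ⟨(R.rank h, ⟨(i, j), hi, hj⟩), ?_, hij⟩)
  intro a b hC hab
  refine lt_of_le_of_ne (not_lt.mp fun hlt => hab.asymm (R.rank_lt_rank h b a hlt)) fun heq => ?_
  exact ht ⟨a, b, fun e => by simp [e] at hab, hC, heq.symm⟩

end PopularityRanking

/-! ### Click probabilities with extreme symmetric types. -/

namespace SearchEnvironment

variable {M : ℕ} {r₁ : Equiv.Perm (Fin M)}

theorem sum_vector_succ {α : Type*} [Fintype α] (n : ℕ) (f : List.Vector α (n + 1) → ℝ) :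
    ∑ v, f v = ∑ v : List.Vector α n, ∑ m, f (m ::ᵥ v) := by
  rw [← Fintype.sum_prod_type']
  refine (Fintype.sum_equiv
    ⟨fun x : List.Vector α n × α => x.2 ::ᵥ x.1, fun v => (v.tail, v.head), fun x => by simp,
      fun v => by simp⟩ _ _ fun x => rfl).symm

theorem sum_historyProb_mul (E : SearchEnvironment M r₁) (n : ℕ) (g : List (Fin M) → ℝ) :
    ∑ h : List.Vector (Fin M) n, E.historyProb h.toList * g h.toList =
      historyExpectation E.clickProb n g := by
  induction n generalizing g with
  | zero => simp [historyExpectation, historyProb]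
  | succ n ih =>
    rw [sum_vector_succ, historyExpectation, ← ih]
    refine Finset.sum_congr rfl fun v _ => ?_
    rw [Finset.mul_sum]
    refine Finset.sum_congr rfl fun m _ => ?_
    rw [List.Vector.toList_cons, historyProb, mul_assoc]

theorem classOneClickProb_eq (E : SearchEnvironment M r₁) (N : ℕ) :
    E.classOneClickProb N =
      historyExpectation E.clickProb (N - 1) fun h => ∑ m ∈ E.classOne, E.clickProb h m :=
  E.sum_historyProb_mul (N - 1) fun h => ∑ m ∈ E.classOne, E.clickProb h m

/-- The attention received by item `m` after the history `h`. -/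
noncomputable def attention (R : PopularityRanking M r₁) (β : ℝ) (h : List (Fin M)) (m : Fin M) :
    ℝ :=
  β ^ (M - ((R.rank h m : ℕ) + 1))

/-- The click probability per unit of attention of the items of `C`. -/
noncomputable def classFactor (R : PopularityRanking M r₁) (β p : ℝ) (C : Finset (Fin M))
    (h : List (Fin M)) : ℝ :=
  p / ∑ m ∈ C, attention R β h m +
    (1 - 2 * p) / (C.card * ((∑ m ∈ C, attention R β h m) / C.card +
      (∑ m ∈ Cᶜ, attention R β h m) / (Cᶜ.card)))

variable {R : PopularityRanking M r₁} {β p : ℝ} {C : Finset (Fin M)} {h : List (Fin M)}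

theorem one_le_attention (hβ : 1 < β) (m : Fin M) : 1 ≤ attention R β h m :=
  one_le_pow₀ hβ.le

theorem attention_pos (hβ : 1 < β) (m : Fin M) : 0 < attention R β h m :=
  zero_lt_one.trans_le (one_le_attention hβ m)

theorem attention_le (hβ : 1 < β) (m : Fin M) : attention R β h m ≤ β ^ M :=
  pow_le_pow_right₀ hβ.le (Nat.sub_le _ _)

theorem mul_attention_le (hβ : 1 < β) {a b : Fin M} (hab : R.rank h a < R.rank h b) :
    β * attention R β h b ≤ attention R β h a := by
  rw [attention, attention, ← pow_succ']
  refine pow_le_pow_right₀ hβ.le ?_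
  have := (R.rank h b).2
  have := Fin.lt_def.mp hab
  omega

theorem attention_le_mul (hβ : 1 < β) {a b : Fin M}
    (hab : (R.rank h a : ℕ) ≤ R.rank h b + 1) :
    attention R β h b ≤ β * attention R β h a := by
  rw [attention, attention, ← pow_succ']
  exact pow_le_pow_right₀ hβ.le (by omega)

theorem sum_attention_pos (hβ : 1 < β) (hC : C.Nonempty) : 0 < ∑ m ∈ C, attention R β h m :=
  Finset.sum_pos (fun m _ => attention_pos hβ m) hC

theorem sum_attention_le (hβ : 1 < β) : ∑ m ∈ C, attention R β h m ≤ C.card * β ^ M := by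
  rw [← nsmul_eq_mul]
  exact Finset.sum_le_card_nsmul _ _ _ fun m _ => attention_le hβ m

theorem card_le_sum_attention (hβ : 1 < β) : (C.card : ℝ) ≤ ∑ m ∈ C, attention R β h m := by
  have := Finset.card_nsmul_le_sum C (attention R β h) 1 fun m _ => one_le_attention hβ m
  simpa using this

theorem sum_attention_mul_propensity (γ : ℝ) :
    ∑ m, attention R β h m * (extremeSymmetric C β p R).propensity γ m =
      (1 - γ) / C.card * ∑ m ∈ C, attention R β h m +
        γ / (Cᶜ.card) * ∑ m ∈ Cᶜ, attention R β h m := by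
  rw [← Finset.sum_add_sum_compl C, Finset.mul_sum, Finset.mul_sum]
  congr 1 <;> refine Finset.sum_congr rfl fun m hm => ?_
  · simp [propensity, extremeSymmetric, hm, mul_comm]
  · simp [propensity, extremeSymmetric, Finset.mem_compl.mp hm, mul_comm]

theorem clickProb_extremeSymmetric (hβ : 1 < β) (hC : C.Nonempty) (hC' : Cᶜ.Nonempty)
    (m : Fin M) :
    (extremeSymmetric C β p R).clickProb h m =
      attention R β h m *
        if m ∈ C then classFactor R β p C h else classFactor R β p Cᶜ h := by
  have hc : (0 : ℝ) < C.card := Nat.cast_pos.mpr hC.card_pos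
  have hc' : (0 : ℝ) < Cᶜ.card := Nat.cast_pos.mpr hC'.card_pos
  have hS : 0 < ∑ m ∈ C, attention R β h m := sum_attention_pos hβ hC
  have hS' : 0 < ∑ m ∈ Cᶜ, attention R β h m := sum_attention_pos hβ hC'
  have htype : ∀ γ, (extremeSymmetric C β p R).typeClickProb γ h m =
      attention R β h m * (if m ∈ C then (1 - γ) / (C.card : ℝ) else γ / (Cᶜ.card : ℝ)) /
        ((1 - γ) / C.card * ∑ m ∈ C, attention R β h m +
        γ / (Cᶜ.card) * ∑ m ∈ Cᶜ, attention R β h m) := by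
    intro γ
    rw [← sum_attention_mul_propensity (p := p)]
    rfl
  have hsum : (extremeSymmetric C β p R).clickProb h m =
      p * (extremeSymmetric C β p R).typeClickProb 1 h m +
      p * (extremeSymmetric C β p R).typeClickProb 0 h m +
      (1 - 2 * p) * (extremeSymmetric C β p R).typeClickProb (1 / 2) h m := by
    rw [clickProb, Fin.sum_univ_three]
    rfl
  rw [hsum, htype, htype, htype, classFactor, classFactor, compl_compl]
  generalize (C.card : ℝ) = c at *
  generalize (Cᶜ.card : ℝ) = c' at *
  generalize ∑ m ∈ C, attention R β h m = S at *
  generalize ∑ m ∈ Cᶜ, attention R β h m = S' at *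
  split_ifs
  · have : 0 < S * c' + S' * c := by positivity
    field_simp
    ring
  · have : 0 < S * c' + S' * c := by positivity
    field_simp
    ring

/-- Swapping the labels exchanges the two extreme types, which are equally frequent, and fixes the
moderate one. -/
theorem clickProb_compl (hβ : 1 < β) (hC : C.Nonempty) (hC' : Cᶜ.Nonempty) :
    (extremeSymmetric Cᶜ β p R).clickProb = (extremeSymmetric C β p R).clickProb := by
  funext h m
  rw [clickProb_extremeSymmetric hβ hC hC',
    clickProb_extremeSymmetric hβ hC' (by simpa using hC), compl_compl]
  by_cases hm : m ∈ C <;> simp [hm]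

theorem sum_clickProb_classOne (hβ : 1 < β) (hC : C.Nonempty) (hC' : Cᶜ.Nonempty) :
    ∑ m ∈ C, (extremeSymmetric C β p R).clickProb h m =
      (∑ m ∈ C, attention R β h m) * classFactor R β p C h := by
  rw [Finset.sum_mul]
  refine Finset.sum_congr rfl fun m hm => ?_
  rw [clickProb_extremeSymmetric hβ hC hC', if_pos hm]

/-- The click probability of a whole class. -/
theorem sum_attention_mul_classFactor (hβ : 1 < β) (hC : C.Nonempty) (hC' : Cᶜ.Nonempty) :
    (∑ m ∈ C, attention R β h m) * classFactor R β p C h =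
      p + (1 - 2 * p) * (Cᶜ.card * ∑ m ∈ C, attention R β h m) /
        (Cᶜ.card * (∑ m ∈ C, attention R β h m) + C.card * ∑ m ∈ Cᶜ, attention R β h m) := by
  have hc : (0 : ℝ) < C.card := Nat.cast_pos.mpr hC.card_pos
  have hc' : (0 : ℝ) < Cᶜ.card := Nat.cast_pos.mpr hC'.card_pos
  have hS : 0 < ∑ m ∈ C, attention R β h m := sum_attention_pos hβ hC
  have hS' : 0 < ∑ m ∈ Cᶜ, attention R β h m := sum_attention_pos hβ hC'
  rw [classFactor]
  generalize (C.card : ℝ) = c at *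
  generalize (Cᶜ.card : ℝ) = c' at *
  generalize ∑ m ∈ C, attention R β h m = S at *
  generalize ∑ m ∈ Cᶜ, attention R β h m = S' at *
  have : 0 < S * c' + S' * c := by positivity
  field_simp

/-- The extreme type devoted to `C` alone guarantees this uniform lower bound, hence a drift bounded
away from zero. -/
theorem le_classFactor (hβ : 1 < β) (hp : 0 < p) (hp' : p < 1 / 2) (hC : C.Nonempty) :
    p / (M * β ^ M) ≤ classFactor R β p C h := by
  have hS : 0 < ∑ m ∈ C, attention R β h m := sum_attention_pos hβ hC
  have hS' : 0 ≤ ∑ m ∈ Cᶜ, attention R β h m :=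
    Finset.sum_nonneg fun m _ => (attention_pos hβ m).le
  have h1 : p / (M * β ^ M) ≤ p / ∑ m ∈ C, attention R β h m := by
    refine div_le_div_of_nonneg_left hp.le hS ((sum_attention_le hβ).trans ?_)
    have : (C.card : ℝ) ≤ M := by
      exact_mod_cast (Finset.card_le_univ C).trans_eq (Fintype.card_fin M)
    gcongr
  have h2 : 0 ≤ 1 - 2 * p := by linarith
  refine h1.trans (le_add_of_nonneg_right ?_)
  positivity

theorem isTransition_clickProb (hβ : 1 < β) (hp : 0 < p) (hp' : p < 1 / 2) (hC : C.Nonempty)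
    (hC' : Cᶜ.Nonempty) : IsTransition (extremeSymmetric C β p R).clickProb := by
  have hβ0 : 0 < β := by linarith
  have hpos : 0 ≤ p / (M * β ^ M) := by positivity
  refine ⟨fun h m => ?_, fun h => ?_⟩
  · rw [clickProb_extremeSymmetric hβ hC hC']
    refine mul_nonneg (attention_pos hβ m).le ?_
    split_ifs
    · exact hpos.trans (le_classFactor hβ hp hp' hC)
    · exact hpos.trans (le_classFactor hβ hp hp' hC')
  · have hC'' : Cᶜᶜ.Nonempty := by simpa using hC
    have hc : (0 : ℝ) < C.card := Nat.cast_pos.mpr hC.card_pos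
    have hc' : (0 : ℝ) < Cᶜ.card := Nat.cast_pos.mpr hC'.card_pos
    have hS : 0 < ∑ m ∈ C, attention R β h m := sum_attention_pos hβ hC
    have hS' : 0 < ∑ m ∈ Cᶜ, attention R β h m := sum_attention_pos hβ hC'
    rw [← Finset.sum_add_sum_compl C, sum_clickProb_classOne hβ hC hC',
      sum_attention_mul_classFactor hβ hC hC', ← clickProb_compl hβ hC hC',
      sum_clickProb_classOne hβ hC' hC'', sum_attention_mul_classFactor hβ hC' hC'', compl_compl,
      add_comm ((C.card : ℝ) * _)]
    have : (Cᶜ.card : ℝ) * (∑ m ∈ C, attention R β h m) +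
      C.card * ∑ m ∈ Cᶜ, attention R β h m ≠ 0 := by positivity
    field_simp
    ring

/-- For few class 1 items and a small share of extreme types, class 1 items get more than `β`
times as many clicks per unit of attention as class 0 items. -/
theorem mul_classFactor_compl_le (hβ : 1 < β) (hp : 0 < p) (hp' : p < 1 / 4) (hC : C.Nonempty)
    (hC' : Cᶜ.Nonempty) :
    Cᶜ.card / (C.card * (1 + 4 * p * β ^ M)) * classFactor R β p Cᶜ h ≤
      classFactor R β p C h := by
  have hc : (0 : ℝ) < C.card := Nat.cast_pos.mpr hC.card_pos
  have hc' : (0 : ℝ) < Cᶜ.card := Nat.cast_pos.mpr hC'.card_pos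
  have hS : 0 < ∑ m ∈ C, attention R β h m := sum_attention_pos hβ hC
  have hS' : 0 < ∑ m ∈ Cᶜ, attention R β h m := sum_attention_pos hβ hC'
  have hSle : ∑ m ∈ C, attention R β h m ≤ C.card * β ^ M := sum_attention_le hβ
  have hSle' : ∑ m ∈ Cᶜ, attention R β h m ≤ Cᶜ.card * β ^ M := sum_attention_le hβ
  have hSge' : (Cᶜ.card : ℝ) ≤ ∑ m ∈ Cᶜ, attention R β h m := card_le_sum_attention hβ
  have hβM : 0 < β ^ M := pow_pos (by linarith) M
  rw [classFactor, classFactor, compl_compl]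
  generalize (C.card : ℝ) = c at *
  generalize (Cᶜ.card : ℝ) = c' at *
  generalize ∑ m ∈ C, attention R β h m = S at *
  generalize ∑ m ∈ Cᶜ, attention R β h m = S' at *
  rw [add_comm (S' / c')]
  set T := S / c + S' / c' with hT
  have hT0 : 0 < T := by positivity
  have hTle : T ≤ 2 * β ^ M := by
    have h1 : S / c ≤ β ^ M := by rwa [div_le_iff₀ hc, mul_comm]
    have h2 : S' / c' ≤ β ^ M := by rwa [div_le_iff₀ hc', mul_comm]
    linarith
  have hq : 1 / 2 ≤ 1 - 2 * p := by linarith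
  -- The extreme term is a small multiple of the moderate one, as `S' ≥ c'`, `T ≤ 2 * β ^ M` and `1
  -- - 2 * p ≥ 1 / 2`. Without extreme terms the ratio of the factors is exactly `c' / c`.
  have h1 : p / S' ≤ (1 - 2 * p) / (c' * T) * (4 * p * β ^ M) := by
    calc p / S' ≤ p / c' := div_le_div_of_nonneg_left hp.le hc' hSge'
      _ = (1 / 2) / (c' * T) * (2 * p * T) := by field_simp
      _ ≤ (1 - 2 * p) / (c' * T) * (2 * p * (2 * β ^ M)) := by gcongr
      _ = _ := by ring
  have hD : 0 < 1 + 4 * p * β ^ M := by positivity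
  calc c' / (c * (1 + 4 * p * β ^ M)) * (p / S' + (1 - 2 * p) / (c' * T))
      ≤ c' / (c * (1 + 4 * p * β ^ M)) * ((1 - 2 * p) / (c' * T) * (1 + 4 * p * β ^ M)) := by
        gcongr
        linarith
    _ = (1 - 2 * p) / (c * T) := by field_simp
    _ ≤ p / S + (1 - 2 * p) / (c * T) := le_add_of_nonneg_left (by positivity)

/-- Being one place lower costs a factor `β` of attention, which the ratio of class factors more
than repays; the quotient by `β` is what remains. -/
theorem favoursClass_clickProb (hβ : 1 < β) (hp : 0 < p) (hp' : p < 1 / 4) (hC : C.Nonempty)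
    (hC' : Cᶜ.Nonempty) (hratio : β < Cᶜ.card / (C.card * (1 + 4 * p * β ^ M))) :
    FavoursClass R (extremeSymmetric C β p R).clickProb C
      (min β (Cᶜ.card / (C.card * (1 + 4 * p * β ^ M)) / β)) (p / (M * β ^ M)) := by
  have hβ0 : 0 < β := by linarith
  have hp2 : p < 1 / 2 := by linarith
  have hM : (0 : ℝ) < M := by
    obtain ⟨m, _⟩ := hC
    exact Nat.cast_pos.mpr m.pos
  have hη : 0 < p / (M * β ^ M) := by positivity
  have hA : ∀ h, 0 < classFactor R β p C h := fun h =>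
    hη.trans_le (le_classFactor hβ hp hp2 hC)
  have hA' : ∀ h, 0 < classFactor R β p Cᶜ h := fun h =>
    hη.trans_le (le_classFactor hβ hp hp2 hC')
  refine ⟨lt_min hβ ((one_lt_div hβ0).mpr hratio), hη, fun h m => ?_, fun h a b hab hr => ?_,
    fun h a b ha hb hr => ?_⟩
  · rw [clickProb_extremeSymmetric hβ hC hC']
    have hw := one_le_attention (R := R) (h := h) hβ m
    split_ifs
    · exact (le_classFactor hβ hp hp2 hC).trans (le_mul_of_one_le_left (hA h).le hw)
    · exact (le_classFactor hβ hp hp2 hC').trans (le_mul_of_one_le_left (hA' h).le hw)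
  · rw [clickProb_extremeSymmetric hβ hC hC', clickProb_extremeSymmetric hβ hC hC']
    have hif : 0 ≤ if a ∈ C then classFactor R β p C h else classFactor R β p Cᶜ h := by
      split_ifs
      · exact (hA h).le
      · exact (hA' h).le
    simp only [← hab]
    rw [← mul_assoc]
    refine mul_le_mul_of_nonneg_right (le_trans ?_ (mul_attention_le hβ hr)) hif
    exact mul_le_mul_of_nonneg_right (min_le_left _ _) (attention_pos hβ b).le
  · rw [clickProb_extremeSymmetric hβ hC hC', clickProb_extremeSymmetric hβ hC hC', if_pos ha,
      if_neg hb]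
    set κ : ℝ := Cᶜ.card / (C.card * (1 + 4 * p * β ^ M)) with hκ
    have hκ0 : 0 < κ := hβ0.trans hratio
    calc min β (κ / β) * (attention R β h b * classFactor R β p Cᶜ h)
        ≤ κ / β * ((β * attention R β h a) * classFactor R β p Cᶜ h) := by
          have := attention_le_mul hβ hr
          have := (hA' h).le
          have := (attention_pos (R := R) (h := h) hβ b).le
          gcongr
          exact min_le_right _ _
      _ = attention R β h a * (κ * classFactor R β p Cᶜ h) := by field_simp
      _ ≤ attention R β h a * classFactor R β p C h :=
          mul_le_mul_of_nonneg_left (mul_classFactor_compl_le hβ hp hp' hC hC')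
            (attention_pos hβ a).le

/-! ### Long-run click shares and conclusion. -/

/-- When the class 1 items lead, they attract a fraction of the moderate individuals bounded away
from one half. -/
theorem le_sum_clickProb_of_mem_classLeads (hβ : 1 < β) (hp' : p < 1 / 2)
    (hC : C.Nonempty) (hC' : Cᶜ.Nonempty) (hh : h ∈ classLeads C) :
    p + (1 - 2 * p) * (β / (1 + β)) ≤
      ∑ m ∈ C, (extremeSymmetric C β p R).clickProb h m := by
  have hc : (0 : ℝ) < C.card := Nat.cast_pos.mpr hC.card_pos
  have hc' : (0 : ℝ) < Cᶜ.card := Nat.cast_pos.mpr hC'.card_pos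
  have hS : 0 < ∑ m ∈ C, attention R β h m := sum_attention_pos hβ hC
  have hS' : 0 < ∑ m ∈ Cᶜ, attention R β h m := sum_attention_pos hβ hC'
  have hle : β * (C.card * ∑ m ∈ Cᶜ, attention R β h m) ≤
      Cᶜ.card * ∑ m ∈ C, attention R β h m := by
    -- Comparing attention over all pairs in `C × Cᶜ` produces the two cardinalities.
    calc β * (C.card * ∑ m ∈ Cᶜ, attention R β h m)
        = ∑ i ∈ C, ∑ j ∈ Cᶜ, β * attention R β h j := by
          rw [Finset.sum_const, nsmul_eq_mul, ← Finset.mul_sum]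
          ring
      _ ≤ ∑ i ∈ C, ∑ j ∈ Cᶜ, attention R β h i :=
          Finset.sum_le_sum fun i hi => Finset.sum_le_sum fun j hj =>
            mul_attention_le hβ (R.rank_lt_rank h i j (hh i hi j (Finset.mem_compl.mp hj)))
      _ = _ := by simp only [Finset.sum_const, nsmul_eq_mul, Finset.mul_sum]
  rw [sum_clickProb_classOne hβ hC hC', sum_attention_mul_classFactor hβ hC hC', mul_div_assoc]
  have hfrac : β / (1 + β) ≤ (Cᶜ.card * ∑ m ∈ C, attention R β h m) /
      (Cᶜ.card * (∑ m ∈ C, attention R β h m) + C.card * ∑ m ∈ Cᶜ, attention R β h m) := by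
    rw [div_le_div_iff₀ (by linarith) (by positivity)]
    linarith
  have : 0 ≤ 1 - 2 * p := by linarith
  gcongr

/-- In the long run a small class attracts more than half of the clicks. -/
theorem eventually_half_lt_classOneClickProb (hβ : 1 < β) (hp : 0 < p) (hp' : p < 1 / 4)
    (hC : C.Nonempty) (hC' : Cᶜ.Nonempty)
    (hratio : β < Cᶜ.card / (C.card * (1 + 4 * p * β ^ M))) :
    ∀ᶠ N in Filter.atTop, 1 / 2 < (extremeSymmetric C β p R).classOneClickProb N := by
  have hp2 : p < 1 / 2 := by linarith
  have hπ : IsTransition (extremeSymmetric C β p R).clickProb :=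
    isTransition_clickProb hβ hp hp2 hC hC'
  obtain ⟨K, θ, hK, hθ, hθ1, hbound⟩ := exponentiallyRare_compl_classLeads hπ
    (favoursClass_clickProb hβ hp hp' hC hC' hratio)
  set q := p + (1 - 2 * p) * (β / (1 + β)) with hq
  have hβ2 : 1 / 2 < β / (1 + β) := by
    rw [div_lt_div_iff₀ two_pos (by linarith)]
    linarith
  -- Here `q - 1 / 2 = (1 - 2 * p) * (β / (1 + β) - 1 / 2)`.
  have hq2 : 1 / 2 < q := by
    rw [hq]
    nlinarith
  have hlow : ∀ n, q - q * (K * θ ^ n) ≤ historyExpectation (extremeSymmetric C β p R).clickProb n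
      fun h => ∑ m ∈ C, (extremeSymmetric C β p R).clickProb h m := by
    intro n
    calc q - q * (K * θ ^ n)
        ≤ q + -q * historyExpectation (extremeSymmetric C β p R).clickProb n
            ((classLeads C)ᶜ.indicator 1) := by nlinarith [hbound n]
      _ = historyExpectation (extremeSymmetric C β p R).clickProb n
            (fun h => q + -q * (classLeads C)ᶜ.indicator 1 h) := by
          rw [historyExpectation_add, historyExpectation_const hπ, historyExpectation_const_mul]
      _ ≤ _ := by
          refine historyExpectation_mono hπ n fun h _ => ?_
          by_cases hh : h ∈ classLeads C
          · rw [Set.indicator_of_notMem (Set.notMem_compl_iff.mpr hh), mul_zero, add_zero]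
            exact le_sum_clickProb_of_mem_classLeads hβ hp2 hC hC' hh
          · rw [Set.indicator_of_mem (Set.mem_compl hh), Pi.one_apply, mul_one, add_neg_cancel]
            exact Finset.sum_nonneg fun m _ => hπ.nonneg h m
  have hlim : Filter.Tendsto (fun n : ℕ => q - q * (K * θ ^ n)) Filter.atTop (nhds q) := by
    have := (((tendsto_pow_atTop_nhds_zero_of_lt_one hθ.le hθ1).const_mul K).const_mul q).const_sub q
    simpa using this
  -- Individual `N` sees `N - 1` earlier clicks, hence the shift.
  have hev := (Filter.tendsto_sub_atTop_nat 1).eventually (hlim.eventually (lt_mem_nhds hq2))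
  filter_upwards [hev] with N hN
  rw [classOneClickProb_eq]
  exact hN.trans_le (hlow (N - 1))

theorem classOneClickProb_add_compl (hβ : 1 < β) (hp : 0 < p) (hp' : p < 1 / 2)
    (hC : C.Nonempty) (hC' : Cᶜ.Nonempty) (N : ℕ) :
    (extremeSymmetric C β p R).classOneClickProb N +
      (extremeSymmetric Cᶜ β p R).classOneClickProb N = 1 := by
  have hπ : IsTransition (extremeSymmetric C β p R).clickProb :=
    isTransition_clickProb hβ hp hp' hC hC'
  rw [classOneClickProb_eq, classOneClickProb_eq, clickProb_compl hβ hC hC',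
    ← historyExpectation_add]
  have : (fun h => (∑ m ∈ (extremeSymmetric C β p R).classOne,
        (extremeSymmetric C β p R).clickProb h m) +
      ∑ m ∈ (extremeSymmetric Cᶜ β p R).classOne, (extremeSymmetric C β p R).clickProb h m) =
      fun _ => 1 := by
    funext h
    exact (Finset.sum_add_sum_compl C _).trans (hπ.sum_eq_one h)
  rw [this, historyExpectation_const hπ]

theorem lt_card_ratio {M k : ℕ} (hβ : 1 < β) (hk : 1 ≤ k) (hp : 0 < p)
    (hpk : p < ((M - k) / (k * β) - 1) / (4 * β ^ M)) :
    β < ((M : ℝ) - k) / (k * (1 + 4 * p * β ^ M)) := by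
  have hβ0 : 0 < β := by linarith
  have hk0 : (0 : ℝ) < k := Nat.cast_pos.mpr hk
  rw [lt_div_iff₀ (by positivity), lt_sub_iff_add_lt, lt_div_iff₀ (by positivity)] at hpk
  rw [lt_div_iff₀ (by positivity)]
  linarith

theorem card_ratio_sub_one_pos {M k : ℕ} (hβ : 1 < β) (hk : 1 ≤ k)
    (hkM : (k : ℝ) < M / (1 + β)) : 0 < (((M : ℝ) - k) / (k * β) - 1) / (4 * β ^ M) := by
  have hβ0 : 0 < β := by linarith
  have hk0 : (0 : ℝ) < k := Nat.cast_pos.mpr hk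
  rw [lt_div_iff₀ (by positivity)] at hkM
  refine div_pos ?_ (by positivity)
  rw [sub_pos, one_lt_div (by positivity)]
  linarith

end SearchEnvironment

open SearchEnvironment in
theorem mainTheorem1 (M M₁ M₁' : ℕ) (β : ℝ) (hβ : 1 < β)
    (hM₁ : 1 ≤ M₁) (hM₁' : M₁' < M)
    (hmin : (M₁ : ℝ) < (M : ℝ) / (1 + β))
    (hmaj : β * (M : ℝ) / (1 + β) < (M₁' : ℝ)) :
    ∃ p₀ : ℝ, 0 < p₀ ∧ p₀ ≤ 1 / 2 ∧
      ∀ p : ℝ, 0 < p → p < p₀ →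
      ∀ (r₁ : Equiv.Perm (Fin M)) (R : PopularityRanking M r₁) (C C' : Finset (Fin M)),
        C.card = M₁ → C'.card = M₁' →
        ∃ N₀ : ℕ, ∀ N : ℕ, N₀ ≤ N →
          (SearchEnvironment.extremeSymmetric C' β p R).classOneClickProb N <
            (SearchEnvironment.extremeSymmetric C β p R).classOneClickProb N := by
  have hβ1 : 0 < 1 + β := by linarith
  have hk' : 1 ≤ M - M₁' := by omega
  have hcast : ((M - M₁' : ℕ) : ℝ) = (M : ℝ) - M₁' := Nat.cast_sub hM₁'.le
  -- The lower bound on `M₁'` says exactly that the complementary class is small.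
  have hmin' : ((M - M₁' : ℕ) : ℝ) < M / (1 + β) := by
    rw [hcast, lt_div_iff₀ hβ1]
    rw [div_lt_iff₀ hβ1] at hmaj
    linarith
  have half : ∀ (k : ℕ) (p : ℝ), 1 ≤ k → (k : ℝ) < M / (1 + β) → 0 < p → p < 1 / 4 →
      p < (((M : ℝ) - k) / (k * β) - 1) / (4 * β ^ M) →
      ∀ (r₁ : Equiv.Perm (Fin M)) (R : PopularityRanking M r₁) (C : Finset (Fin M)), C.card = k →
        C.Nonempty ∧ Cᶜ.Nonempty ∧
          ∀ᶠ N in Filter.atTop, 1 / 2 < (extremeSymmetric C β p R).classOneClickProb N := by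
    intro k p hk hkM hp hp4 hpk r₁ R C hCk
    have hkM' : k < M := by
      have : (M : ℝ) / (1 + β) ≤ M := div_le_self (Nat.cast_nonneg M) (by linarith)
      exact_mod_cast hkM.trans_le this
    have hcard : Cᶜ.card = M - k := by rw [Finset.card_compl, Fintype.card_fin, hCk]
    have hC : C.Nonempty := Finset.card_pos.mp (by omega)
    have hC' : Cᶜ.Nonempty := Finset.card_pos.mp (by omega)
    refine ⟨hC, hC', eventually_half_lt_classOneClickProb hβ hp hp4 hC hC' ?_⟩
    rw [hcard, hCk, Nat.cast_sub hkM'.le]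
    exact lt_card_ratio hβ hk hp hpk
  -- The two inner bounds, for `k = M₁` and `k = M - M₁'`, are the values of `p` at which the ratio
  -- of class factors guaranteed by `mul_classFactor_compl_le` drops to `β`.
  refine ⟨min (1 / 4) (min _ _), lt_min (by norm_num) (lt_min
    (card_ratio_sub_one_pos hβ hM₁ hmin) (card_ratio_sub_one_pos hβ hk' hmin')),
    (min_le_left _ _).trans (by norm_num), fun p hp hp₀ r₁ R C C' hC hC' => ?_⟩
  obtain ⟨hp4, hp₁, hp₂⟩ : p < 1 / 4 ∧ _ ∧ _ := by simpa only [lt_min_iff] using hp₀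
  obtain ⟨-, -, h₁⟩ := half M₁ p hM₁ hmin hp hp4 hp₁ r₁ R C hC
  obtain ⟨hne, hne', h₂⟩ := half (M - M₁') p hk' hmin' hp hp4 hp₂ r₁ R C'ᶜ
    (by rw [Finset.card_compl, Fintype.card_fin, hC'])
  rw [compl_compl] at hne'
  refine Filter.eventually_atTop.mp ?_
  filter_upwards [h₁, h₂] with N hN₁ hN₂
  have := classOneClickProb_add_compl (R := R) hβ hp (by linarith) hne' hne N
  linarith
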